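/- Let $H$ be a complex Hilbert space and let $P$ be a bounded idempotent operator on $H$ ($P^2=P$, not necessarily self-adjoint). For a bounded operator $T$ between Hilbert spaces write $N(T)$ and $R(T)$ for its null space and range. For a closed subspace $M\subseteq H$ let $P_M$ be the orthogonal projection of $H$ onto $M$; for a bounded operator $A$ on $H$ let $P_A$ be the orthogonal projection of $H$ onto $\overline{R(A)}$. For self-adjoint $A$ let $A^{+}=\frac{|A|+A}{2}$ and $A^{-}=\frac{|A|-A}{2}$. Let $P_1\colon R(P)^\perp\to R(P)$ and $Q_1\colon R(I-P)^\perp\to R(I-P)$ be the bounded operators with $$P=\begin{pmatrix} I & P_1\\ 0 & 0\end{pmatrix}\ \text{ on } R(P)\oplus R(P)^\perp,\qquad I-P=\begin{pmatrix} I & Q_1\\ 0 & 0\end{pmatrix}\ \text{ on } R(I-P)\oplus R(I-P)^\perp .$$ Then: (i) $P_{(2I-P-P^*)^+}=P_{(P+P^*)^-}+P_{N(P+P^*)}$; (ii) $P_{N(P_1^*)}=P_{N(Q_1)}$ and $P_{N(P_1)}=P_{N(Q_1^*)}$, where these null spaces are regarded as closed subspaces of $H$; (iii) $P_{(2I-P-P^*)^-}+P_{N(2I-P-P^*)}=P_{(P+P^*)^+}$.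 -/

import Mathlib

open scoped InnerProduct

/-- The range of a bounded idempotent operator on a Hilbert space is closed, hence complete. -/
theorem IsIdempotentElem.completeSpace_range {H : Type*} [NormedAddCommGroup H]
    [InnerProductSpace ℂ H] [CompleteSpace H] {P : H →L[ℂ] H} (hP : IsIdempotentElem P) :
    CompleteSpace P.range := by
  have h : IsClosed (P.range : Set H) := ContinuousLinearMap.IsIdempotentElem.isClosed_range hP
  exact h.completeSpace_coe

/-- The orthogonal projection, as an operator on `H`, onto the closure of the subspace `M`
(that is, onto `M` itself when `M` is closed, as is the case for every null space). -/
noncomputable def orthProj {H : Type*} [NormedAddCommGroup H] [InnerProductSpace ℂ H]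
    [CompleteSpace H] (M : Submodule ℂ H) : H →L[ℂ] H :=
  M.topologicalClosure.starProjection

/-- `rangeProj A` is the orthogonal projection onto the closure of the range of `A`. -/
noncomputable def rangeProj {H : Type*} [NormedAddCommGroup H] [InnerProductSpace ℂ H]
    [CompleteSpace H] (A : H →L[ℂ] H) : H →L[ℂ] H :=
  orthProj A.range

/-- `nullProj T` is the orthogonal projection onto the null space of an operator `T : M → K`
defined on a subspace `M` of `H`; the null space is regarded as a subspace of `H`, and the
projection as an operator on `H`. -/
noncomputable def nullProj {H : Type*} [NormedAddCommGroup H] [InnerProductSpace ℂ H]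
    [CompleteSpace H] {M K : Submodule ℂ H} (T : M →L[ℂ] K) : H →L[ℂ] H :=
  orthProj (T.ker.map M.subtype)

/-- `T` has the operator matrix `(A, B; C, D)` with respect to the decomposition `M ⊕ Mᗮ`:
`T (x + y) = (A x + B y) + (C x + D y)` for all `x ∈ M` and `y ∈ Mᗮ`. -/
def HasOperatorMatrix {H : Type*} [NormedAddCommGroup H] [InnerProductSpace ℂ H]
    (T : H →L[ℂ] H) (M : Submodule ℂ H)
    (A : M →L[ℂ] M) (B : Mᗮ →L[ℂ] M) (C : M →L[ℂ] Mᗮ) (D : Mᗮ →L[ℂ] Mᗮ) : Prop :=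
  ∀ (x : M) (y : Mᗮ),
    T ((x : H) + (y : H)) = (((A x + B y : M) : H)) + ((C x + D y : Mᗮ) : H)

/-! Put A = P + P* - 1, so that P + P* = 1 + A and 2 - P - P* = 1 - A. Idempotency gives A² - 1 = (P
- P*)(P - P*)* ≥ 0, so the spectrum of A misses (-1, 1). The two sides of (i) project onto the
spectral subspaces of A for (-∞, 1) and (-∞, -1], which the gap makes equal
(`rangeProj_posPart_one_sub`). The gap also makes this projection a continuous function of A. Part
(iii) is (i) for 1 - P. For (ii), N(P₁) = {Px = P*x = 0} and N(P₁*) = {Px = P*x = x}; passing to 1 -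
P swaps these conditions. -/

section SpectralGap

variable {H : Type*} [NormedAddCommGroup H] [InnerProductSpace ℂ H] [CompleteSpace H]

/-- If `E` is an orthogonal projection and `T` has the same range as `E`, then `E` is the
range projection of `T`. -/
theorem rangeProj_eq_of_mul_eq {E T G : H →L[ℂ] H} (hE : IsStarProjection E)
    (hT : E * T = T) (hG : T * G = E) : rangeProj T = E := by
  ext x
  refine Submodule.eq_starProjection_of_mem_orthogonal
    (Submodule.le_topologicalClosure _ ⟨G x, congr($hG x)⟩) ?_
  rw [Submodule.orthogonal_closure, Submodule.mem_orthogonal]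
  rintro _ ⟨z, rfl⟩
  have hz : T z = E (T z) := congr($hT.symm z)
  have hx : E (E x) = E x := congr($(hE.isIdempotentElem.eq) x)
  rw [ContinuousLinearMap.coe_coe, hz, ← ContinuousLinearMap.adjoint_inner_right,
    ← ContinuousLinearMap.star_eq_adjoint, hE.isSelfAdjoint.star_eq, map_sub, hx, sub_self,
    inner_zero_right]

/-- The orthogonal complement of the range of a self-adjoint operator is its null space. -/
theorem mem_orthogonal_range_iff_of_isSelfAdjoint {T : H →L[ℂ] H} (hT : IsSelfAdjoint T)
    {x : H} : x ∈ (T.range)ᗮ ↔ T x = 0 := by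
  rw [ContinuousLinearMap.orthogonal_range, ← ContinuousLinearMap.star_eq_adjoint, hT.star_eq]
  rfl

/-- If `E` is an orthogonal projection whose complement factors through `S`, and `E` commutes
with `S`, then `E` is the sum of the projections onto the closed range of `E * S` and onto
the null space of `S`. -/
theorem rangeProj_add_orthProj_ker {E S N F : H →L[ℂ] H} (hE : IsStarProjection E)
    (hN : IsSelfAdjoint N) (hES : E * S = -N) (hSE : S * E = -N) (hF : F * S = 1 - E) :
    rangeProj N + orthProj S.ker = E := by
  ext x
  set q : H := rangeProj N x with hq
  have hEE : ∀ v, E (E v) = E v := fun v => congr($(hE.isIdempotentElem.eq) v)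
  have hNv : ∀ v, N v = -E (S v) := fun v => by
    simpa using (congr(-$hES v)).symm
  have hNv' : ∀ v, S (E v) = -N v := fun v => congr($hSE v)
  have hEN : E * N = N := by
    ext v
    simp [hNv, hEE]
  have hq_mem : q ∈ (N.range).topologicalClosure := Submodule.starProjection_apply_mem _ _
  have hEq : E q = q := by
    have hle : (N.range).topologicalClosure ≤ (1 - E).ker :=
      Submodule.topologicalClosure_minimal _
        (by
          rintro _ ⟨z, rfl⟩
          have : E (N z) = N z := congr($hEN z)
          simp [this])
        (1 - E).isClosed_ker
    have : q - E q = 0 := hle hq_mem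
    exact (sub_eq_zero.mp this).symm
  have hNq : N (x - q) = 0 := by
    rw [← mem_orthogonal_range_iff_of_isSelfAdjoint hN, ← Submodule.orthogonal_closure]
    exact Submodule.sub_starProjection_mem_orthogonal x
  have hclosed : S.ker.topologicalClosure = S.ker :=
    S.isClosed_ker.submodule_topologicalClosure_eq
  suffices orthProj S.ker x = E x - q by
    simp [← hq, this]
  refine Submodule.eq_starProjection_of_mem_orthogonal
    (Submodule.le_topologicalClosure _ ?_) ?_
  · change S (E x - q) = 0
    rw [← hEq, ← map_sub, hNv', hNq, neg_zero]
  · rw [hclosed, Submodule.mem_orthogonal]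
    intro w hw
    have hSw : S w = 0 := hw
    -- `F` inverts `S` on the range of 1 - E, so the null space of `S` lies in the range of `E`.
    have hEw : E w = w := by
      have : F (S w) = w - E w := congr($hF w)
      rw [hSw, map_zero] at this
      exact (sub_eq_zero.mp this.symm).symm
    have hwN : w ∈ ((N.range).topologicalClosure)ᗮ := by
      rw [Submodule.orthogonal_closure, mem_orthogonal_range_iff_of_isSelfAdjoint hN, hNv, hSw,
        map_zero, neg_zero]
    have h1 : inner ℂ w q = 0 := Submodule.inner_left_of_mem_orthogonal hq_mem hwN
    have h2 : inner ℂ w (x - E x) = 0 := by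
      rw [← hEw, ← ContinuousLinearMap.adjoint_inner_right,
        ← ContinuousLinearMap.star_eq_adjoint, hE.isSelfAdjoint.star_eq, map_sub, hEE, sub_self,
        inner_zero_right]
    rw [show x - (E x - q) = (x - E x) + q by abel, inner_add_right, h1, h2, add_zero]

/-- If `A` is self-adjoint with `1 ≤ A ^ 2`, its spectrum does not meet the interval `(-1, 1)`. -/
theorem one_le_sq_of_mem_spectrum {A : H →L[ℂ] H} (hA : IsSelfAdjoint A) (h : (0 : H →L[ℂ] H) ≤ A * A - 1)
    {x : ℝ} (hx : x ∈ spectrum ℝ A) : x ≤ -1 ∨ 1 ≤ x := by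
  have h1 : cfc (fun x : ℝ => x * x - 1) A = A * A - 1 := by
    rw [cfc_sub (fun x : ℝ => x * x) (fun _ => 1) A, cfc_mul (fun x : ℝ => x) (fun x => x) A,
      cfc_id' ℝ A, cfc_const_one ℝ A]
  rw [← h1, cfc_nonneg_iff (fun x : ℝ => x * x - 1) A] at h
  have := h x hx
  by_contra! hlt
  nlinarith

theorem cfc_one_add {A : H →L[ℂ] H} (hA : IsSelfAdjoint A) :
    cfc (fun x : ℝ => 1 + x) A = 1 + A := by
  rw [cfc_add A (fun _ : ℝ => (1 : ℝ)) (fun x => x), cfc_id' ℝ A, cfc_const_one ℝ A]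

theorem negPart_one_add_eq_cfc {A : H →L[ℂ] H} (hA : IsSelfAdjoint A) :
    (1 + A)⁻ = cfc (fun x : ℝ => (1 + x)⁻) A := by
  rw [CFC.negPart_def, cfcₙ_eq_cfc, ← cfc_one_add hA, ← cfc_comp' (fun x : ℝ => x⁻) (fun x => 1 + x) A]

theorem posPart_one_sub_eq_cfc {A : H →L[ℂ] H} (hA : IsSelfAdjoint A) :
    (1 - A)⁺ = cfc (fun x : ℝ => (1 - x)⁺) A := by
  have h1 : cfc (fun x : ℝ => 1 - x) A = 1 - A := by
    rw [cfc_sub (fun _ : ℝ => (1 : ℝ)) (fun x => x) A, cfc_id' ℝ A, cfc_const_one ℝ A]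
  rw [CFC.posPart_def, cfcₙ_eq_cfc, ← h1, ← cfc_comp' (fun x : ℝ => x⁺) (fun x => 1 - x) A]

/-- A continuous function equal to `1` on `(-∞, -1]` and to `0` on `[1, ∞)`. -/
noncomputable def negCutoff (x : ℝ) : ℝ := min 1 (max 0 ((1 - x) / 2))

@[fun_prop]
theorem continuous_negCutoff : Continuous negCutoff := by
  unfold negCutoff
  fun_prop

theorem negCutoff_of_le {x : ℝ} (hx : x ≤ -1) : negCutoff x = 1 := by
  rw [negCutoff, max_eq_right (by linarith), min_eq_left (by linarith)]

theorem negCutoff_of_ge {x : ℝ} (hx : 1 ≤ x) : negCutoff x = 0 := by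
  rw [negCutoff, max_eq_left (by linarith), min_eq_right (by linarith)]

/-- The denominator never vanishes; it equals 1 - x for x ≤ -1 and 1 + x for x ≥ 1, so it supplies
both partial inverses. -/
theorem continuous_div_one_add_abs {f : ℝ → ℝ} (hf : Continuous f) :
    Continuous fun x : ℝ => f x / (1 + |x|) :=
  hf.div (by fun_prop) fun x => by positivity

/-- For self-adjoint `A` with `1 ≤ A ^ 2`, the spectral subspaces of `A` for `(-∞, 1)` and
`(-∞, -1]` agree. -/
theorem rangeProj_posPart_one_sub {A : H →L[ℂ] H} (hA : IsSelfAdjoint A)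
    (h : (0 : H →L[ℂ] H) ≤ A * A - 1) :
    rangeProj ((1 - A)⁺) = rangeProj ((1 + A)⁻) + orthProj (1 + A).ker := by
  have hsp := fun {x : ℝ} (hx : x ∈ spectrum ℝ A) => one_le_sq_of_mem_spectrum hA h hx
  have hcG := continuous_div_one_add_abs continuous_negCutoff
  have hcF := continuous_div_one_add_abs (f := fun x => 1 - negCutoff x) (by fun_prop)
  have hE : IsStarProjection (cfc negCutoff A) := by
    refine ⟨?_, cfc_predicate negCutoff A⟩
    rw [IsIdempotentElem, ← cfc_mul negCutoff negCutoff A]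
    refine cfc_congr fun x hx => ?_
    rcases hsp hx with hx | hx
    · simp [negCutoff_of_le hx]
    · simp [negCutoff_of_ge hx]
  have hS := cfc_one_add hA
  have hN : ∀ x ∈ spectrum ℝ A, negCutoff x * (1 + x) = -(1 + x)⁻ := fun x hx => by
    rcases hsp hx with hx | hx
    · rw [negCutoff_of_le hx, negPart_of_nonpos (by linarith)]
      ring
    · rw [negCutoff_of_ge hx, negPart_of_nonneg (by linarith)]
      ring
  -- `G` inverts (1 - A)⁺ on the range of `E`, and `F` inverts 1 + A on the complement. All
  -- remaining identities are checked pointwise on the two halves of the spectrum.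
  rw [rangeProj_eq_of_mul_eq (E := cfc negCutoff A)
      (G := cfc (fun x : ℝ => negCutoff x / (1 + |x|)) A) hE,
    rangeProj_add_orthProj_ker (E := cfc negCutoff A)
      (F := cfc (fun x : ℝ => (1 - negCutoff x) / (1 + |x|)) A) hE]
  · exact (CFC.negPart_nonneg _).isSelfAdjoint
  · rw [negPart_one_add_eq_cfc hA, ← hS, ← cfc_mul negCutoff (fun x : ℝ => 1 + x) A,
      ← cfc_neg]
    exact cfc_congr hN
  · rw [negPart_one_add_eq_cfc hA, ← hS, ← cfc_mul (fun x : ℝ => 1 + x) negCutoff A,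
      ← cfc_neg]
    exact cfc_congr fun x hx => (mul_comm _ _).trans (hN x hx)
  · rw [← hS, ← cfc_mul _ (fun x : ℝ => 1 + x) A hcF.continuousOn, ← cfc_const_one ℝ A,
      ← cfc_sub (fun _ : ℝ => (1 : ℝ)) negCutoff A]
    refine cfc_congr fun x hx => ?_
    rcases hsp hx with hx | hx
    · simp [negCutoff_of_le hx]
    · simp only [negCutoff_of_ge hx, abs_of_nonneg (by linarith : 0 ≤ x)]
      field_simp
  · rw [posPart_one_sub_eq_cfc hA, ← cfc_mul negCutoff (fun x : ℝ => (1 - x)⁺) A]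
    refine cfc_congr fun x hx => ?_
    rcases hsp hx with hx | hx
    · simp [negCutoff_of_le hx]
    · simp [negCutoff_of_ge hx, posPart_of_nonpos (by linarith : 1 - x ≤ 0)]
  · rw [posPart_one_sub_eq_cfc hA,
      ← cfc_mul (fun x : ℝ => (1 - x)⁺) _ A (by fun_prop) hcG.continuousOn]
    refine cfc_congr fun x hx => ?_
    rcases hsp hx with hx | hx
    · have : 1 - x ≠ 0 := by linarith
      simp only [negCutoff_of_le hx, abs_of_nonpos (by linarith : x ≤ 0),
        posPart_of_nonneg (by linarith : 0 ≤ 1 - x), ← sub_eq_add_neg]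
      field_simp
    · simp [negCutoff_of_ge hx]

end SpectralGap

section Idempotent

variable {H : Type*} [NormedAddCommGroup H] [InnerProductSpace ℂ H] {P : H →L[ℂ] H}

theorem IsIdempotentElem.mem_range_iff_apply_eq (hP : IsIdempotentElem P) {x : H} :
    x ∈ P.range ↔ P x = x :=
  ⟨by rintro ⟨z, rfl⟩; exact congr($(hP.eq) z), fun h => ⟨x, h⟩⟩

theorem HasOperatorMatrix.coe_apply_right {P₁ : (P.range)ᗮ →L[ℂ] P.range}
    (hP₁ : HasOperatorMatrix P P.range 1 P₁ 0 0) (y : (P.range)ᗮ) : (P₁ y : H) = P y := by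
  simpa using (hP₁ 0 y).symm

variable [CompleteSpace H]

theorem IsIdempotentElem.add_adjoint_sub_one_sq (hP : IsIdempotentElem P) :
    0 ≤ (P + P† - 1) * (P + P† - 1) - 1 := by
  rw [← ContinuousLinearMap.star_eq_adjoint]
  have h : (P + Star.star P - 1) * (P + Star.star P - 1) - 1 = (P - Star.star P) * Star.star (P - Star.star P) := by
    have h1 := hP.eq
    have h2 := hP.star.eq
    simp only [star_sub, star_star, sub_mul, mul_sub, add_mul, mul_add, h1, h2, one_mul, mul_one]
    abel
  rw [h]
  exact mul_star_self_nonneg _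

theorem IsIdempotentElem.rangeProj_posPart_two_sub (hP : IsIdempotentElem P) :
    rangeProj (((2 : ℂ) • (1 : H →L[ℂ] H) - P - P†)⁺)
      = rangeProj ((P + P†)⁻) + orthProj (P + P†).ker := by
  have hA : IsSelfAdjoint (P + P† - 1) := by
    rw [← ContinuousLinearMap.star_eq_adjoint]
    exact (IsSelfAdjoint.add_star_self P).sub (.one _)
  have h := rangeProj_posPart_one_sub hA hP.add_adjoint_sub_one_sq
  rwa [add_sub_cancel, show 1 - (P + P† - 1) = (2 : ℂ) • (1 : H →L[ℂ] H) - P - P† by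
    rw [two_smul]; abel] at h

/-- P₁ is the restriction of P to R(P)ᗮ = N(P*). -/
theorem HasOperatorMatrix.mem_map_ker_iff {P₁ : (P.range)ᗮ →L[ℂ] P.range}
    (hP₁ : HasOperatorMatrix P P.range 1 P₁ 0 0) {x : H} :
    x ∈ P₁.ker.map (P.range)ᗮ.subtype ↔ P x = 0 ∧ (P†) x = 0 := by
  have hmem : ∀ z, z ∈ (P.range)ᗮ ↔ (P†) z = 0 := fun z => by
    rw [ContinuousLinearMap.orthogonal_range]
    rfl
  constructor
  · rintro ⟨y, hy, rfl⟩
    have hy : P₁ y = 0 := hy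
    refine ⟨?_, (hmem _).1 y.2⟩
    rw [Submodule.subtype_apply, ← hP₁.coe_apply_right, hy, Submodule.coe_zero]
  · rintro ⟨h1, h2⟩
    refine ⟨⟨x, (hmem x).2 h2⟩, Subtype.ext ?_, rfl⟩
    exact (hP₁.coe_apply_right _).trans h1

theorem HasOperatorMatrix.mem_map_ker_adjoint_iff [CompleteSpace P.range]
    (hP : IsIdempotentElem P) {P₁ : (P.range)ᗮ →L[ℂ] P.range}
    (hP₁ : HasOperatorMatrix P P.range 1 P₁ 0 0) {x : H} :
    x ∈ (P₁†).ker.map P.range.subtype ↔ P x = x ∧ (P†) x = x := by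
  constructor
  · rintro ⟨u, hu, rfl⟩
    have hu : (P₁†) u = 0 := hu
    have hPu : P (u : H) = u := hP.mem_range_iff_apply_eq.1 u.2
    refine ⟨hPu, ext_inner_left ℂ fun z => ?_⟩
    -- P fixes `r`, while P₁*u = 0 makes `u` orthogonal to P y; hence ⟨Pz, u⟩ = ⟨z, u⟩.
    obtain ⟨r, hr, y, hy, rfl⟩ := P.range.exists_add_mem_mem_orthogonal z
    have h1 : inner ℂ (P y) (u : H) = 0 := by
      rw [← hP₁.coe_apply_right ⟨y, hy⟩, ← Submodule.coe_inner,
        ← ContinuousLinearMap.adjoint_inner_right, hu, inner_zero_right]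
    rw [Submodule.subtype_apply, ContinuousLinearMap.adjoint_inner_right, map_add,
      hP.mem_range_iff_apply_eq.1 hr, inner_add_left, inner_add_left, h1,
      Submodule.inner_left_of_mem_orthogonal u.2 hy]
  · rintro ⟨h1, h2⟩
    have hx : x ∈ P.range := hP.mem_range_iff_apply_eq.2 h1
    refine ⟨⟨x, hx⟩, ?_, rfl⟩
    refine ext_inner_left ℂ fun y => ?_
    rw [inner_zero_right]
    change inner ℂ y ((P₁†) ⟨x, hx⟩) = 0
    rw [ContinuousLinearMap.adjoint_inner_right, Submodule.coe_inner, hP₁.coe_apply_right,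
      ← ContinuousLinearMap.adjoint_inner_right, h2]
    exact Submodule.inner_left_of_mem_orthogonal hx y.2

end Idempotent

theorem theorem12 {H : Type*} [NormedAddCommGroup H] [InnerProductSpace ℂ H] [CompleteSpace H]
    (P : H →L[ℂ] H) (hP : IsIdempotentElem P)
    (P₁ : (P.range)ᗮ →L[ℂ] P.range)
    (Q₁ : ((1 - P).range)ᗮ →L[ℂ] (1 - P).range)
    (hP₁ : HasOperatorMatrix P P.range 1 P₁ 0 0)
    (hQ₁ : HasOperatorMatrix (1 - P) (1 - P).range 1 Q₁ 0 0) :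
    haveI : CompleteSpace P.range := hP.completeSpace_range
    haveI : CompleteSpace (1 - P).range := hP.one_sub.completeSpace_range
    (rangeProj (((2 : ℂ) • (1 : H →L[ℂ] H) - P - P†)⁺)
        = rangeProj ((P + P†)⁻) + orthProj (P + P†).ker) ∧
    (nullProj (P₁†) = nullProj Q₁ ∧ nullProj P₁ = nullProj (Q₁†)) ∧
    (rangeProj (((2 : ℂ) • (1 : H →L[ℂ] H) - P - P†)⁻)
        + orthProj ((2 : ℂ) • (1 : H →L[ℂ] H) - P - P†).ker
        = rangeProj ((P + P†)⁺)) := by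
  have : CompleteSpace P.range := hP.completeSpace_range
  have : CompleteSpace (1 - P).range := hP.one_sub.completeSpace_range
  have hadj : (1 - P)† = 1 - P† := by
    simp only [← ContinuousLinearMap.star_eq_adjoint, star_sub, star_one]
  refine ⟨hP.rangeProj_posPart_two_sub, ⟨?_, ?_⟩, ?_⟩
  · refine congrArg orthProj (Submodule.ext fun x => ?_)
    rw [hP₁.mem_map_ker_adjoint_iff hP, hQ₁.mem_map_ker_iff, hadj]
    simp only [sub_apply, one_apply_eq_self, sub_eq_zero,
      eq_comm (a := x)]
  · refine congrArg orthProj (Submodule.ext fun x => ?_)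
    rw [hP₁.mem_map_ker_iff, hQ₁.mem_map_ker_adjoint_iff hP.one_sub, hadj]
    simp
  · have h := hP.one_sub.rangeProj_posPart_two_sub
    rw [hadj, show (2 : ℂ) • (1 : H →L[ℂ] H) - (1 - P) - (1 - P†) = P + P† by
        rw [two_smul]; abel,
      show (1 - P) + (1 - P†) = (2 : ℂ) • (1 : H →L[ℂ] H) - P - P† by
        rw [two_smul]; abel] at h
    exact h.symm
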